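/- Let $m\ge 2$ agents form a connected undirected network $G$ and let $W\in\mathbb R^{m\times m}$ be a weight matrix of it: $W$ is symmetric, $W_{ij}\neq 0$ if and only if $i,j$ are adjacent in $G$ or $i=j$, $0\preceq W\preceq I$, $W\mathbf 1=\mathbf 1$ and $\mathrm{null}(I-W)=\mathrm{span}(\mathbf 1)$. Let $\lambda_2(W)$ be its second largest eigenvalue. Let $F(x)=\frac1m\sum_{i=1}^m f_i(x)+g(x)$ on $\mathbb R^d$, where each $f_i:\mathbb R^d\to\mathbb R$ is differentiable, convex and $L$-smooth, i.e. $0\le f_i(y)-f_i(x)-\langle\nabla f_i(x),y-x\rangle\le\frac L2\|x-y\|^2$ for all $x,y$, with $L>0$, and $g:\mathbb R^d\to\mathbb R$ is convex. Assume that $F$ has a minimizer $x^*$. For an $m\times d$ matrix $\mathbf x$ with rows $\mathbf x^{(i)}$ let $\overline x$ be the average of its rows, $\nabla f(\mathbf x)$ the matrix with rows $\nabla f_i(\mathbf x^{(i)})$, and $\mathrm{prox}_{\gamma g}(\mathbf x)$ the matrix whose $i$-th row is $\operatorname{argmin}_w\big(\gamma g(w)+\frac12\|w-\mathbf x^{(i)}\|^2\big)$.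 $\mathrm{FastMix}(\mathbf x,K)$ sets $\mathbf x^0=\mathbf x^1=\mathbf x$, performs the $K$ communication rounds $\mathbf x^{k+1}=(1+\eta_w)W\mathbf x^k-\eta_w\mathbf x^{k-1}$, $k=1,\dots,K$, with $\eta_w=1/(1+\sqrt{1-\lambda_2(W)^2})$, and returns $\mathbf x^K$. ODAPG starts from $x_1\in\mathbb R^d$ with $\mathbf x_1=\mathbf y_1=\mathbf z_1=\mathbf 1x_1$, $\mathbf s_1=\nabla f(\mathbf x_1)$, and iterates for $t=1,2,\dots$ $$\mathbf x_{t+1}=\tau_t\mathbf z_t+(1-\tau_t)\mathbf y_t,\qquad \mathbf s_{t+1}=\mathrm{FastMix}(\mathbf s_t+\nabla f(\mathbf x_{t+1})-\nabla f(\mathbf x_t),K),$$ $$\mathbf z_{t+1}=\mathrm{FastMix}(\mathrm{prox}_{\gamma_t g}(\mathbf z_t-\gamma_t\mathbf s_{t+1}),K),\qquad \mathbf y_{t+1}=\mathrm{FastMix}(\tau_t\mathbf z_{t+1}+(1-\tau_t)\mathbf y_t,K),$$ with $\gamma_t=\frac{t+4}{400L}$, $\tau_t=\frac2{t+4}$ and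 $K=\lceil 15/\sqrt{1-\lambda_2(W)}\,\rceil$. Then, to find an $\epsilon$-suboptimal solution, i.e. $F(\overline y)-F(x^*)\le\epsilon$, each agent needs $\mathcal O(1/\sqrt\epsilon)$ gradient computations and $\mathcal O\big(1/\sqrt{\epsilon(1-\lambda_2(W))}\big)$ communication rounds. Precisely: for all reals $L>0$ and $\Delta,D,S$ there are constants $c_1,c_2>0$, depending only on $L,\Delta,D,S$, such that for every problem, network and starting point as above with $F(x_1)-F(x^*)\le\Delta$, $\|x_1-x^*\|\le D$ and $\sum_{i=1}^m\big\|\nabla f_i(x_1)-\frac1m\sum_{j=1}^m\nabla f_j(x_1)\big\|^2\le S$, and for every $0<\epsilon\le 1$, there is $T\in\mathbb N$ such that the first $T$ iterations of ODAPG use, for each agent, at most $c_1/\sqrt\epsilon$ gradient computations (the one at the initialization included) and at most $c_2/\sqrt{\epsilon(1-\lambda_2(W))}$ communication rounds, and after $T$ or more iterations the current average $\overline y$ satisfies $F(\overline y)-F(x^*)\le\epsilon$. -/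

import Mathlib

noncomputable section

namespace Decentralized

/-- The space of decision variables, with the Euclidean norm. -/
abbrev Vec (d : ℕ) : Type := EuclideanSpace ℝ (Fin d)

/-- An `m × d` matrix, as the family of its rows; row `i` is the local copy of agent `i`. -/
abbrev Stack (m d : ℕ) : Type := Fin m → Vec d

/-- The average of the rows. -/
def average {m d : ℕ} (x : Stack m d) : Vec d := (m : ℝ)⁻¹ • ∑ i, x i

/-- The squared Frobenius norm of `x - 1 x̄`, the squared consensus error. -/
def consensusErrorSq {m d : ℕ} (x : Stack m d) : ℝ := ∑ i, ‖x i - average x‖ ^ 2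

/-- `φ` is convex and `L`-smooth. -/
structure IsConvexSmooth {d : ℕ} (L : ℝ) (φ : Vec d → ℝ) : Prop where
  differentiable : Differentiable ℝ φ
  lower : ∀ x y, φ x + inner ℝ (gradient φ x) (y - x) ≤ φ y
  upper : ∀ x y, φ y ≤ φ x + inner ℝ (gradient φ x) (y - x) + L / 2 * ‖x - y‖ ^ 2

/-- The composite objective `F = (1/m) ∑ fᵢ + g`. -/
def objective {m d : ℕ} (f : Fin m → Vec d → ℝ) (g : Vec d → ℝ) (x : Vec d) : ℝ :=
  (m : ℝ)⁻¹ * ∑ i, f i x + g x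

/-- The aggregate gradient: row `i` is the gradient of `fᵢ` at row `i` of `x`. -/
def aggGradient {m d : ℕ} (f : Fin m → Vec d → ℝ) (x : Stack m d) : Stack m d :=
  fun i => gradient (f i) (x i)

/-- `w` minimizes `γ g(w) + ‖w - x‖² / 2`. -/
def IsProx {d : ℕ} (γ : ℝ) (g : Vec d → ℝ) (x w : Vec d) : Prop :=
  ∀ w', γ * g w + 1 / 2 * ‖w - x‖ ^ 2 ≤ γ * g w' + 1 / 2 * ‖w' - x‖ ^ 2

/-- The proximal operator: the minimizer of `γ g(w) + ‖w - x‖² / 2`. -/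
def prox {d : ℕ} (γ : ℝ) (g : Vec d → ℝ) (x : Vec d) : Vec d :=
  Classical.epsilon (IsProx γ g x)

/-- The aggregated proximal operator, acting on each row. -/
def aggProx {m d : ℕ} (γ : ℝ) (g : Vec d → ℝ) (x : Stack m d) : Stack m d :=
  fun i => prox γ g (x i)

/-- `W` is a mixing (weight) matrix of the connected network `G`. -/
structure IsMixingMatrix {m : ℕ} (G : SimpleGraph (Fin m)) (W : Matrix (Fin m) (Fin m) ℝ) :
    Prop where
  connected : G.Connected
  symm : W.IsSymm
  support : ∀ i j, W i j ≠ 0 ↔ G.Adj i j ∨ i = j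
  posSemidef : W.PosSemidef
  le_one : (1 - W).PosSemidef
  mulVec_one : W.mulVec (fun _ => 1) = fun _ => 1
  ker_eq : LinearMap.ker (1 - W).mulVecLin = Submodule.span ℝ {(fun _ => 1 : Fin m → ℝ)}

/-- The second largest eigenvalue, counted with multiplicity, of a symmetric matrix of size at
least two (`eigenvalues₀` lists the eigenvalues in decreasing order, starting at index `0`). -/
def lambda2 {m : ℕ} (W : Matrix (Fin m) (Fin m) ℝ) : ℝ :=
  if h : W.IsHermitian ∧ 1 < Fintype.card (Fin m) then h.1.eigenvalues₀ ⟨1, h.2⟩ else 0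

/-- One round of local communication: the product `W x`. -/
def mix {m d : ℕ} (W : Matrix (Fin m) (Fin m) ℝ) (x : Stack m d) : Stack m d :=
  fun i => ∑ j, W i j • x j

/-- The momentum parameter of the accelerated gossip. -/
def etaW {m : ℕ} (W : Matrix (Fin m) (Fin m) ℝ) : ℝ := 1 / (1 + √(1 - lambda2 W ^ 2))

/-- The memory of the `FastMix` loop, with the number of communication rounds made so far. -/
structure FastMixState (m d : ℕ) where
  prev : Stack m d
  cur : Stack m d
  rounds : ℕ

/-- The state of `FastMix` after `k` passes of its loop, started at `x`: `prev` is `x^k` and `cur`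
is `x^(k+1)`, where `x^0 = x^1 = x`. -/
def fastMixLoop {m d : ℕ} (W : Matrix (Fin m) (Fin m) ℝ) (x : Stack m d) : ℕ → FastMixState m d
  | 0 => ⟨x, x, 0⟩
  | k + 1 =>
    let st := fastMixLoop W x k
    ⟨st.cur, (1 + etaW W) • mix W st.cur - etaW W • st.prev, st.rounds + 1⟩

/-- The output `x^K` of `FastMix` with `K` passes. -/
def fastMix {m d : ℕ} (W : Matrix (Fin m) (Fin m) ℝ) (K : ℕ) (x : Stack m d) : Stack m d :=
  (fastMixLoop W x K).prev

/-- The number of communication rounds made by `FastMix` with `K` passes. -/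
def fastMixRounds {m d : ℕ} (W : Matrix (Fin m) (Fin m) ℝ) (K : ℕ) (x : Stack m d) : ℕ :=
  (fastMixLoop W x K).rounds

/-- The memory of the algorithm. `grad` holds the local gradients at `x`; `gradCalls` and `rounds`
count the gradients computed by each agent and the communication rounds made so far. -/
structure State (m d : ℕ) where
  x : Stack m d
  y : Stack m d
  z : Stack m d
  s : Stack m d
  grad : Stack m d
  gradCalls : ℕ
  rounds : ℕ

/-- The initialization at the point `x₁`: all agents start at `x₁` and compute one gradient. -/
def initState {m d : ℕ} (f : Fin m → Vec d → ℝ) (x₁ : Vec d) : State m d where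
  x := fun _ => x₁
  y := fun _ => x₁
  z := fun _ => x₁
  s := aggGradient f fun _ => x₁
  grad := aggGradient f fun _ => x₁
  gradCalls := 1
  rounds := 0

/-- One pass of the main loop, with step size `γ`, coupling weight `τ` and `K` passes of
`FastMix`. -/
def step {m d : ℕ} (f : Fin m → Vec d → ℝ) (g : Vec d → ℝ) (W : Matrix (Fin m) (Fin m) ℝ)
    (K : ℕ) (γ τ : ℝ) (st : State m d) : State m d :=
  let x := τ • st.z + (1 - τ) • st.y
  let grad := aggGradient f x
  let sIn := st.s + grad - st.grad
  let s := fastMix W K sIn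
  let zIn := aggProx γ g (st.z - γ • s)
  let z := fastMix W K zIn
  let yIn := τ • z + (1 - τ) • st.y
  { x := x
    y := fastMix W K yIn
    z := z
    s := s
    grad := grad
    gradCalls := st.gradCalls + 1
    rounds := st.rounds + fastMixRounds W K sIn + fastMixRounds W K zIn + fastMixRounds W K yIn }

/-- The algorithm with step sizes `γ t` and weights `τ t`: the state after `n` passes of its main
loop (for `t = 1, …, n`), which holds the iterates with index `n + 1`. -/
def odapg {m d : ℕ} (f : Fin m → Vec d → ℝ) (g : Vec d → ℝ) (W : Matrix (Fin m) (Fin m) ℝ)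
    (K : ℕ) (γ τ : ℕ → ℝ) (x₁ : Vec d) : ℕ → State m d
  | 0 => initState f x₁
  | n + 1 => step f g W K (γ (n + 1)) (τ (n + 1)) (odapg f g W K γ τ x₁ n)

/-- The step size `γ_t = (t + 4) / (2 L c)` with `c = 200`. -/
def stepSize (L : ℝ) (t : ℕ) : ℝ := (t + 4) / (2 * L * 200)

/-- The weight `τ_t = 2 / (t + 4)`. -/
def weight (t : ℕ) : ℝ := 2 / (t + 4)

/-- The number of passes of `FastMix`: `15 / √(1 - λ₂(W))`, rounded up. -/
def mixSteps {m : ℕ} (W : Matrix (Fin m) (Fin m) ℝ) : ℕ := ⌈15 / √(1 - lambda2 W)⌉₊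

/-- The run of the algorithm with the parameters for a general convex regularizer. -/
def convexRun {m d : ℕ} (f : Fin m → Vec d → ℝ) (g : Vec d → ℝ) (W : Matrix (Fin m) (Fin m) ℝ)
    (L : ℝ) (x₁ : Vec d) : ℕ → State m d :=
  odapg f g W (mixSteps W) (stepSize L) weight x₁

end Decentralized

end

/-! Mixing preserves the average of the rows, so the averages of `y` and `z` follow an accelerated
proximal gradient method perturbed by consensus errors. On each nonconstant eigenvector of `W`,
`FastMix` is a scalar second-order recursion with complex characteristic roots of modulus √η_w.
Hence `mixSteps W` rounds, a multiple of 1/√(1 - λ₂), divide every squared consensus error by at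
least 10000 (`consensusErrorSq_fastMix_le`).

Everything is then carried by one Lyapunov function, `energy`, which does not increase
(`energy_step_le`) when its weight `a` is 1/τ². The delicate term is the error of `s`, driven by the
change of each ∇fᵢ between iterations. This change is split at ∇fᵢ(ȳ). The part from ȳ to the new
`x` is paid by the negative gradient term that cocoercivity leaves in `smooth_average_le`. The part
from the old `x` to ȳ is bounded by the distance from `x` to ȳ, which is why `energy` contains that
distance. Its new value is τ²‖z̄' - z̄‖² plus the consensus error of the new `x`; the first summand
is paid by the movement term of the proximal step (`aggProx_average_le`).

After n iterations the weight is (n + 4)²/4, so the suboptimality is O(1/n²). All errors are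
averaged over the agents, so the constants do not depend on m. -/

noncomputable section

namespace Decentralized

/-! ### Smooth convex functions and proximal points. -/

section ConvexAnalysis

variable {d : ℕ} {L γ : ℝ} {φ g : Vec d → ℝ}

/-- The gradient step from `y` for φ minus its tangent at `x` is bounded below by that tangent and
above by smoothness at `y`. -/
theorem IsConvexSmooth.add_sq_norm_gradient_sub_le (h : IsConvexSmooth L φ) (hL : 0 < L)
    (x y : Vec d) :
    φ x + inner ℝ (gradient φ x) (y - x) + 1 / (2 * L) * ‖gradient φ y - gradient φ x‖ ^ 2
      ≤ φ y := by
  set v := gradient φ y - gradient φ x with hv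
  have h1 := h.lower x (y - L⁻¹ • v)
  have h2 := h.upper y (y - L⁻¹ • v)
  have e1 : inner ℝ (gradient φ x) (y - L⁻¹ • v - x)
      = inner ℝ (gradient φ x) (y - x) - L⁻¹ * inner ℝ (gradient φ x) v := by
    rw [show y - L⁻¹ • v - x = (y - x) - L⁻¹ • v by abel, inner_sub_right, inner_smul_right]
  have e2 : inner ℝ (gradient φ y) (y - L⁻¹ • v - y) = - (L⁻¹ * inner ℝ (gradient φ y) v) := by
    rw [show y - L⁻¹ • v - y = - (L⁻¹ • v) by abel, inner_neg_right, inner_smul_right]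
  have e3 : ‖y - (y - L⁻¹ • v)‖ ^ 2 = L⁻¹ ^ 2 * ‖v‖ ^ 2 := by
    rw [sub_sub_cancel, norm_smul, mul_pow, Real.norm_eq_abs, sq_abs]
  have e4 : inner ℝ (gradient φ y) v - inner ℝ (gradient φ x) v = ‖v‖ ^ 2 := by
    rw [← inner_sub_left, ← hv, real_inner_self_eq_norm_sq]
  rw [e1] at h1
  rw [e2, e3] at h2
  have e5 : L / 2 * (L⁻¹ ^ 2 * ‖v‖ ^ 2) = 1 / (2 * L) * ‖v‖ ^ 2 := by field_simp
  have e6 : L⁻¹ * inner ℝ (gradient φ y) v - L⁻¹ * inner ℝ (gradient φ x) v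
      = 2 * (1 / (2 * L) * ‖v‖ ^ 2) := by
    rw [← mul_sub, e4]; field_simp
  linarith

theorem IsConvexSmooth.sq_norm_gradient_sub_le (h : IsConvexSmooth L φ) (hL : 0 < L)
    (x y : Vec d) : ‖gradient φ x - gradient φ y‖ ^ 2 ≤ L ^ 2 * ‖x - y‖ ^ 2 := by
  have h1 := h.add_sq_norm_gradient_sub_le hL x y
  have h2 := h.add_sq_norm_gradient_sub_le hL y x
  have e : inner ℝ (gradient φ x) (y - x) + inner ℝ (gradient φ y) (x - y)
      = - inner ℝ (gradient φ x - gradient φ y) (x - y) := by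
    rw [← neg_sub x y, inner_neg_right, inner_sub_left]; ring
  rw [norm_sub_rev (gradient φ y)] at h1
  have h3 := real_inner_le_norm (gradient φ x - gradient φ y) (x - y)
  set p := ‖gradient φ x - gradient φ y‖
  set q := ‖x - y‖
  have hp : 0 ≤ p := norm_nonneg _
  have hq : 0 ≤ q := norm_nonneg _
  have h4 : 1 / L * p ^ 2 ≤ p * q := by
    have : 1 / L * p ^ 2 = 1 / (2 * L) * p ^ 2 + 1 / (2 * L) * p ^ 2 := by field_simp; ring
    linarith
  have h5 : p ^ 2 ≤ L * (p * q) := by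
    have := mul_le_mul_of_nonneg_left h4 hL.le
    rwa [← mul_assoc, mul_one_div_cancel hL.ne', one_mul] at this
  have h6 : p ≤ L * q := by
    rcases hp.eq_or_lt with h0 | h0
    · rw [← h0]; positivity
    · nlinarith
  calc p ^ 2 ≤ (L * q) ^ 2 := by gcongr
    _ = _ := by ring

/-- A finite convex function is continuous and decreases at most linearly, so the quadratic term
makes the sum coercive. Existence is what gives `prox`, a choice by `epsilon`, its meaning. -/
theorem exists_isProx (hg : ConvexOn ℝ Set.univ g) (hγ : 0 ≤ γ) (x : Vec d) :
    ∃ w, IsProx γ g x w := by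
  have hc : Continuous g := by
    rw [← continuousOn_univ]; exact hg.continuousOn isOpen_univ
  obtain ⟨C, hC⟩ := (isCompact_closedBall x 1).exists_bound_of_continuousOn hc.continuousOn
  have hC0 : 0 ≤ C := (norm_nonneg _).trans (hC x (by simp))
  -- Convexity on the segment from `x` to `w`, at the point where it crosses the unit sphere around
  -- `x`.
  have hlow : ∀ w, 1 ≤ ‖w - x‖ → -(2 * C) * ‖w - x‖ ≤ g w := by
    intro w hw
    set r := ‖w - x‖ with hr
    have hr0 : 0 < r := by linarith
    have hp : (1 - r⁻¹) • x + r⁻¹ • w ∈ Metric.closedBall x 1 := by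
      rw [mem_closedBall_iff_norm, show (1 - r⁻¹) • x + r⁻¹ • w - x = r⁻¹ • (w - x) by module,
        norm_smul, Real.norm_eq_abs, abs_of_pos (inv_pos.2 hr0), ← hr, inv_mul_cancel₀ hr0.ne']
    have h1 := hg.2 (Set.mem_univ x) (Set.mem_univ w)
      (sub_nonneg.2 (inv_le_one_of_one_le₀ hw)) (inv_nonneg.2 hr0.le) (by ring)
    have h2 := (abs_le.1 (hC _ hp)).1
    have h3 := (abs_le.1 (hC x (by simp))).2
    simp only [smul_eq_mul] at h1
    have h4 : r * (-C) ≤ r * ((1 - r⁻¹) * g x + r⁻¹ * g w) := by gcongr; linarith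
    have h5 : r * ((1 - r⁻¹) * g x + r⁻¹ * g w) = (r - 1) * g x + g w := by field_simp
    nlinarith
  have hcont : Continuous fun w => γ * g w + 1 / 2 * ‖w - x‖ ^ 2 := by fun_prop
  obtain ⟨w, hw⟩ := hcont.exists_forall_le' x (by
    have hev : ∀ᶠ w in Filter.cocompact (Vec d), max 1 (4 * γ * C + 2 * γ * |g x|) ≤ ‖w - x‖ := by
      have := tendsto_dist_right_cocompact_atTop x
      simp only [← dist_eq_norm]
      exact this.eventually_ge_atTop _
    filter_upwards [hev] with w hw
    have h1 := hlow w ((le_max_left _ _).trans hw)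
    have h2 := (le_max_right _ _).trans hw
    have h3 := (le_max_left _ _).trans hw
    have h4 := mul_le_mul_of_nonneg_left h1 hγ
    have h5 : γ * g x ≤ γ * |g x| := mul_le_mul_of_nonneg_left (le_abs_self _) hγ
    have h6 : 0 ≤ γ * |g x| := by positivity
    simp only [sub_self, norm_zero]
    nlinarith)
  exact ⟨w, hw⟩

theorem isProx_prox (hg : ConvexOn ℝ Set.univ g) (hγ : 0 ≤ γ) (x : Vec d) :
    IsProx γ g x (prox γ g x) :=
  Classical.epsilon_spec (exists_isProx hg hγ x)

/-- The proximal objective is 1-strongly convex: compare `w` with (1 - t)w + tu, divide by t and let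
t tend to 0. -/
theorem IsProx.add_sq_norm_sub_le {x w : Vec d} (h : IsProx γ g x w)
    (hg : ConvexOn ℝ Set.univ g) (hγ : 0 ≤ γ) (u : Vec d) :
    γ * g w + 1 / 2 * ‖w - x‖ ^ 2 + 1 / 2 * ‖u - w‖ ^ 2 ≤ γ * g u + 1 / 2 * ‖u - x‖ ^ 2 := by
  have key : ∀ t : ℝ, 0 < t → t ≤ 1 → γ * g w + 1 / 2 * ‖w - x‖ ^ 2 + 1 / 2 * ‖u - w‖ ^ 2
      ≤ γ * g u + 1 / 2 * ‖u - x‖ ^ 2 + t * (1 / 2 * ‖u - w‖ ^ 2) := by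
    intro t ht ht1
    have h1 := h ((1 - t) • w + t • u)
    have h2 := mul_le_mul_of_nonneg_left
      (hg.2 (Set.mem_univ w) (Set.mem_univ u) (sub_nonneg.2 ht1) ht.le (by ring)) hγ
    simp only [smul_eq_mul] at h2
    have e : ‖(1 - t) • w + t • u - x‖ ^ 2
        = (1 - t) * ‖w - x‖ ^ 2 + t * ‖u - x‖ ^ 2 - t * (1 - t) * ‖u - w‖ ^ 2 := by
      rw [show (1 - t) • w + t • u - x = (1 - t) • (w - x) + t • (u - x) by module,
        show u - w = (u - x) - (w - x) by abel, norm_add_sq_real, norm_sub_sq_real (u - x),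
        norm_smul, norm_smul, inner_smul_left, inner_smul_right, mul_pow, mul_pow,
        Real.norm_eq_abs, Real.norm_eq_abs, sq_abs, sq_abs, real_inner_comm (u - x)]
      simp only [conj_trivial]
      ring
    rw [e] at h1
    refine le_of_mul_le_mul_left ?_ ht
    nlinarith
  refine le_of_forall_pos_le_add fun ε hε => ?_
  have hs : 0 ≤ 1 / 2 * ‖u - w‖ ^ 2 := by positivity
  set q := 1 / 2 * ‖u - w‖ ^ 2
  have ht : 0 < min 1 (ε / (q + 1)) := by positivity
  have := key _ ht (min_le_left _ _)
  have h3 : min 1 (ε / (q + 1)) * q ≤ ε := by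
    calc _ ≤ ε / (q + 1) * (q + 1) := by gcongr; exacts [min_le_right _ _, by linarith]
      _ = ε := by field_simp
  linarith

end ConvexAnalysis

/-! ### Averages and consensus errors. -/

section Consensus

variable {m d : ℕ}

theorem average_add (x y : Stack m d) : average (x + y) = average x + average y := by
  simp [average, Finset.sum_add_distrib]

theorem average_sub (x y : Stack m d) : average (x - y) = average x - average y := by
  simp [average, Finset.sum_sub_distrib, smul_sub]

theorem average_smul (c : ℝ) (x : Stack m d) : average (c • x) = c • average x := by
  simp [average, ← Finset.smul_sum, smul_comm c]

theorem smul_average (hm : 0 < m) (x : Stack m d) : (m : ℝ) • average x = ∑ i, x i := by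
  have : (m : ℝ) ≠ 0 := by positivity
  rw [average, smul_smul, mul_inv_cancel₀ this, one_smul]

theorem sum_sub_average (hm : 0 < m) (x : Stack m d) : ∑ i, (x i - average x) = 0 := by
  rw [Finset.sum_sub_distrib, ← smul_average hm]
  simp [Nat.cast_smul_eq_nsmul]

theorem average_const (hm : 0 < m) (v : Vec d) : average (fun _ : Fin m => v) = v := by
  have : (m : ℝ) ≠ 0 := by positivity
  rw [average, Finset.sum_const, Finset.card_univ, Fintype.card_fin, ← Nat.cast_smul_eq_nsmul ℝ,
    smul_smul, inv_mul_cancel₀ this, one_smul]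

theorem consensusErrorSq_nonneg (x : Stack m d) : 0 ≤ consensusErrorSq x :=
  Finset.sum_nonneg fun _ _ => by positivity

theorem consensusErrorSq_const (hm : 0 < m) (v : Vec d) :
    consensusErrorSq (fun _ : Fin m => v) = 0 := by
  simp [consensusErrorSq, average_const hm]

/-- Splits the sum orthogonally into a mean part and a deviation part; the deviations sum to zero,
so no cross terms remain. -/
theorem sum_inner_sub (hm : 0 < m) (s w : Stack m d) (u : Vec d) :
    ∑ i, inner ℝ (s i) (w i - u) = m * inner ℝ (average s) (average w - u)
      + ∑ i, inner ℝ (s i - average s) (w i - average w) := by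
  have h : ∀ i, inner ℝ (s i) (w i - u) = inner ℝ (s i) (average w - u)
      + inner ℝ (s i - average s) (w i - average w)
      + inner ℝ (average s) (w i - average w) := by
    intro i
    rw [show w i - u = (average w - u) + (w i - average w) by abel, inner_add_right, add_assoc,
      ← inner_add_left, sub_add_cancel]
  simp_rw [h, Finset.sum_add_distrib, ← inner_sum, ← sum_inner]
  rw [sum_sub_average hm, ← smul_average hm, inner_smul_left]
  simp

theorem sum_sq_norm_sub (hm : 0 < m) (x : Stack m d) (u : Vec d) :
    ∑ i, ‖x i - u‖ ^ 2 = m * ‖average x - u‖ ^ 2 + consensusErrorSq x := by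
  have h := sum_inner_sub hm (fun i => x i - u) x u
  have e : average (fun i => x i - u) = average x - u := by
    have := average_sub x (fun _ => u)
    rwa [average_const hm] at this
  simp only [e, real_inner_self_eq_norm_sq, sub_sub_sub_cancel_right] at h
  exact h

theorem consensusErrorSq_le_sum (hm : 0 < m) (x : Stack m d) :
    consensusErrorSq x ≤ ∑ i, ‖x i‖ ^ 2 := by
  have := sum_sq_norm_sub hm x 0
  simp only [sub_zero] at this
  rw [this]
  have : 0 ≤ (m : ℝ) * ‖average x‖ ^ 2 := by positivity
  linarith

theorem sq_norm_add_le {E : Type*} [NormedAddCommGroup E] [InnerProductSpace ℝ E] (a b : E) :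
    ‖a + b‖ ^ 2 ≤ 2 * ‖a‖ ^ 2 + 2 * ‖b‖ ^ 2 := by
  have h := parallelogram_law_with_norm ℝ a b
  nlinarith [mul_self_nonneg ‖a - b‖]

theorem consensusErrorSq_add_le (x y : Stack m d) :
    consensusErrorSq (x + y) ≤ 2 * consensusErrorSq x + 2 * consensusErrorSq y := by
  simp only [consensusErrorSq, Finset.mul_sum, ← Finset.sum_add_distrib]
  refine Finset.sum_le_sum fun i _ => ?_
  rw [average_add, Pi.add_apply, add_sub_add_comm]
  exact sq_norm_add_le _ _

theorem consensusErrorSq_smul (c : ℝ) (x : Stack m d) :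
    consensusErrorSq (c • x) = c ^ 2 * consensusErrorSq x := by
  simp only [consensusErrorSq, Finset.mul_sum]
  refine Finset.sum_congr rfl fun i _ => ?_
  rw [average_smul, Pi.smul_apply, ← smul_sub, norm_smul, mul_pow, Real.norm_eq_abs, sq_abs]

end Consensus

/-! ### Spectral decomposition of the mixing matrix. -/

section Spectrum

variable {m d : ℕ} {W : Matrix (Fin m) (Fin m) ℝ} {G : SimpleGraph (Fin m)}

theorem IsMixingMatrix.eq_const_of_mulVec_eq (hW : IsMixingMatrix G W) {v : Fin m → ℝ}
    (hv : W.mulVec v = v) : ∃ c, ∀ j, v j = c := by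
  have : v ∈ LinearMap.ker (1 - W).mulVecLin := by
    simp [hv]
  rw [hW.ker_eq, Submodule.mem_span_singleton] at this
  obtain ⟨c, rfl⟩ := this
  exact ⟨c, fun j => by simp⟩

/-- An orthonormal eigenbasis of a mixing matrix: one vector is constant, the eigenvalues of the
others lie between `0` and `λ₂(W) < 1`. -/
theorem IsMixingMatrix.exists_eigenbasis (hW : IsMixingMatrix G W) (hm : 2 ≤ m) :
    (0 ≤ lambda2 W ∧ lambda2 W < 1) ∧
    ∃ (b : OrthonormalBasis (Fin m) ℝ (EuclideanSpace ℝ (Fin m))) (μ : Fin m → ℝ) (i₀ : Fin m),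
      (∀ i, W.mulVec (b i) = μ i • (b i : Fin m → ℝ)) ∧ (∃ c, ∀ j, b i₀ j = c) ∧
      ∀ i ≠ i₀, 0 ≤ μ i ∧ μ i ≤ lambda2 W ∧ ∑ j, b i j = 0 := by
  have hH : W.IsHermitian := hW.posSemidef.1
  have hcard : 1 < Fintype.card (Fin m) := by rw [Fintype.card_fin]; omega
  have hl : lambda2 W = hH.eigenvalues₀ ⟨1, hcard⟩ := dif_pos ⟨hH, hcard⟩
  let e : Fin (Fintype.card (Fin m)) ≃ Fin m := Fintype.equivOfCardEq (Fintype.card_fin _)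
  have hμ : ∀ k, hH.eigenvalues (e k) = hH.eigenvalues₀ k := fun k => by
    simp only [Matrix.IsHermitian.eigenvalues]
    congr 1
    exact e.symm_apply_apply k
  set b := hH.eigenvectorBasis with hb
  have heig : ∀ i, W.mulVec (b i) = hH.eigenvalues i • (b i : Fin m → ℝ) :=
    hH.mulVec_eigenvectorBasis
  have hnorm : ∀ i, (b i : Fin m → ℝ) ⬝ᵥ (b i : Fin m → ℝ) = 1 := fun i => by
    have := real_inner_self_eq_norm_sq (b i)
    rwa [b.orthonormal.1 i, EuclideanSpace.inner_eq_star_dotProduct, star_trivial, one_pow] at this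
  have horth : ∀ i k, i ≠ k → (b i : Fin m → ℝ) ⬝ᵥ (b k : Fin m → ℝ) = 0 := fun i k h => by
    have := b.orthonormal.2 h
    simpa [PiLp.inner_apply, dotProduct, mul_comm] using this
  have hle : ∀ i, hH.eigenvalues i ≤ 1 := fun i => by
    have := hW.le_one.dotProduct_mulVec_nonneg (b i : Fin m → ℝ)
    rw [Matrix.sub_mulVec, heig, Matrix.one_mulVec, star_trivial, dotProduct_sub,
      dotProduct_smul, hnorm, smul_eq_mul] at this
    linarith
  have hsum : ∀ i, hH.eigenvalues i ≠ 1 → ∑ j, b i j = 0 := fun i hi => by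
    have h1 : W.mulVec (b i) ⬝ᵥ (fun _ => 1) = (b i : Fin m → ℝ) ⬝ᵥ (fun _ => 1) := by
      rw [← Matrix.vecMul_transpose, hW.symm.eq, ← Matrix.dotProduct_mulVec, hW.mulVec_one]
    rw [heig, smul_dotProduct, smul_eq_mul] at h1
    have h2 : (hH.eigenvalues i - 1) * ((b i : Fin m → ℝ) ⬝ᵥ (fun _ => 1)) = 0 := by
      rw [sub_mul, h1]; ring
    simpa [dotProduct, sub_ne_zero.2 hi] using h2
  set i₀ := e ⟨0, by omega⟩ with hi₀
  set i₁ := e ⟨1, hcard⟩ with hi₁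
  have h01 : i₁ ≠ i₀ := by simp [hi₀, hi₁]
  -- If the largest eigenvalue were not 1, no eigenvalue would be, all eigenvectors would be
  -- orthogonal to the vector of ones, and Parseval would give it norm 0.
  have htop : hH.eigenvalues i₀ = 1 := by
    by_contra hne
    have hall : ∀ i, ∑ j, b i j = 0 := fun i => hsum i fun h => hne <| by
      refine le_antisymm (hle _) ?_
      rw [← h, hi₀, hμ, ← e.apply_symm_apply i, hμ]
      exact hH.eigenvalues₀_antitone (Fin.mk_le_of_le_val (Nat.zero_le _))
    have h0 := b.sum_sq_norm_inner_right (WithLp.toLp 2 fun _ => 1)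
    rw [EuclideanSpace.real_norm_sq_eq] at h0
    have h1 : (0 : ℝ) = m := by simpa [PiLp.inner_apply, hall] using h0
    have h2 : m = 0 := by exact_mod_cast h1.symm
    omega
  have hconst : ∀ i, hH.eigenvalues i = 1 → ∃ c, ∀ j, b i j = c := fun i hi =>
    hW.eq_const_of_mulVec_eq (by rw [heig, hi, one_smul])
  obtain ⟨c, hc⟩ := hconst i₀ htop
  have hc0 : c ≠ 0 := by
    rintro rfl
    simpa [dotProduct, hc] using hnorm i₀
  have hzero : ∀ i ≠ i₀, ∑ j, b i j = 0 := fun i hi => by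
    have := horth i i₀ hi
    simpa [dotProduct, hc, ← Finset.sum_mul, hc0] using this
  have hl1 : lambda2 W = hH.eigenvalues i₁ := by rw [hl, hi₁, hμ]
  refine ⟨⟨?_, ?_⟩, b, hH.eigenvalues, i₀, heig, ⟨c, hc⟩, fun i hi => ⟨?_, ?_, hzero i hi⟩⟩
  · rw [hl1]; exact hW.posSemidef.eigenvalues_nonneg _
  · refine lt_of_le_of_ne (hl1 ▸ hle i₁) fun h => ?_
    obtain ⟨c', hc'⟩ := hconst i₁ (hl1 ▸ h)
    have h1 := hzero i₁ h01
    have h2 := hnorm i₁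
    simp only [hc', Finset.sum_const, Finset.card_univ, Fintype.card_fin, nsmul_eq_mul,
      mul_eq_zero, Nat.cast_eq_zero] at h1
    rcases h1 with h1 | h1
    · omega
    · simp [dotProduct, hc', h1] at h2
  · exact hW.posSemidef.eigenvalues_nonneg _
  · rw [hl, ← e.apply_symm_apply i, hμ]
    refine hH.eigenvalues₀_antitone (Fin.mk_le_of_le_val (Nat.one_le_iff_ne_zero.2 fun h => hi ?_))
    rw [hi₀, ← e.apply_symm_apply i]
    congr 1
    exact Fin.ext h

/-- The coefficient of the stack `x` along the vector `v`. -/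
def coeff (v : Fin m → ℝ) (x : Stack m d) : Vec d := ∑ j, v j • x j

theorem coeff_sub (v : Fin m → ℝ) (x y : Stack m d) :
    coeff v (x - y) = coeff v x - coeff v y := by
  simp [coeff, smul_sub]

theorem coeff_smul (v : Fin m → ℝ) (c : ℝ) (x : Stack m d) :
    coeff v (c • x) = c • coeff v x := by
  simp [coeff, Finset.smul_sum, smul_comm c]

theorem coeff_mix (hW : W.IsSymm) {v : Fin m → ℝ} {μ : ℝ} (hv : W.mulVec v = μ • v)
    (x : Stack m d) : coeff v (mix W x) = μ • coeff v x := by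
  have h : ∀ k, ∑ j, v j * W j k = μ * v k := fun k => by
    have := congrFun hv k
    simp only [Matrix.mulVec, dotProduct, Pi.smul_apply, smul_eq_mul] at this
    rw [← this]
    exact Finset.sum_congr rfl fun j _ => by rw [mul_comm, hW.apply]
  simp only [coeff, mix, Finset.smul_sum, smul_smul]
  rw [Finset.sum_comm]
  exact Finset.sum_congr rfl fun k _ => by rw [← Finset.sum_smul, h]

/-- Parseval in ℝ^m, applied to each of the `d` columns. -/
theorem sum_sq_norm_coeff (b : OrthonormalBasis (Fin m) ℝ (EuclideanSpace ℝ (Fin m)))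
    (x : Stack m d) : ∑ i, ‖coeff (b i) x‖ ^ 2 = ∑ j, ‖x j‖ ^ 2 := by
  simp only [EuclideanSpace.real_norm_sq_eq]
  rw [Finset.sum_comm, Finset.sum_comm (s := Finset.univ (α := Fin m))]
  refine Finset.sum_congr rfl fun a _ => ?_
  have h := b.sum_sq_norm_inner_right (WithLp.toLp 2 fun j => x j a)
  rw [EuclideanSpace.real_norm_sq_eq] at h
  simpa [coeff, PiLp.inner_apply, mul_comm] using h

/-- Subtracting the average removes the component along the constant vector and leaves the others
unchanged. -/
theorem consensusErrorSq_eq_sum_coeff (hm : 0 < m)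
    (b : OrthonormalBasis (Fin m) ℝ (EuclideanSpace ℝ (Fin m))) {i₀ : Fin m}
    (h₀ : ∃ c, ∀ j, b i₀ j = c) (h : ∀ i ≠ i₀, ∑ j, b i j = 0) (x : Stack m d) :
    consensusErrorSq x = ∑ i ∈ Finset.univ.erase i₀, ‖coeff (b i) x‖ ^ 2 := by
  have e := sum_sq_norm_coeff b (x - fun _ => average x)
  simp only [Pi.sub_apply] at e
  rw [consensusErrorSq, ← e, ← Finset.add_sum_erase _ _ (Finset.mem_univ i₀)]
  obtain ⟨c, hc⟩ := h₀
  have z : coeff (b i₀) (x - fun _ => average x) = 0 := by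
    have := sum_sub_average hm x
    simp only [coeff, hc, Pi.sub_apply, ← Finset.smul_sum, this, smul_zero]
  rw [z, norm_zero, zero_pow two_ne_zero, zero_add]
  refine Finset.sum_congr rfl fun i hi => ?_
  rw [coeff_sub]
  simp [coeff, ← Finset.sum_smul, h i (Finset.ne_of_mem_erase hi)]

end Spectrum

/-! ### Accelerated gossip. -/

section FastMix

variable {m d : ℕ} {W : Matrix (Fin m) (Fin m) ℝ} {G : SimpleGraph (Fin m)}

theorem fastMixRounds_eq (W : Matrix (Fin m) (Fin m) ℝ) (K : ℕ) (x : Stack m d) :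
    fastMixRounds W K x = K := by
  induction K with
  | zero => rfl
  | succ k ih => exact congrArg (· + 1) ih

theorem IsMixingMatrix.average_mix (hW : IsMixingMatrix G W) (x : Stack m d) :
    average (mix W x) = average x := by
  have h : ∀ k, ∑ j, W j k = 1 := fun k => by
    have := congrFun hW.mulVec_one k
    simp only [Matrix.mulVec, dotProduct, mul_one] at this
    rw [← this]
    exact Finset.sum_congr rfl fun j _ => hW.symm.apply _ _
  simp only [average, mix]
  rw [Finset.sum_comm]
  simp [← Finset.sum_smul, h]

theorem IsMixingMatrix.average_fastMixLoop (hW : IsMixingMatrix G W) (x : Stack m d) (k : ℕ) :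
    average (fastMixLoop W x k).prev = average x ∧
      average (fastMixLoop W x k).cur = average x := by
  induction k with
  | zero => exact ⟨rfl, rfl⟩
  | succ k ih =>
    refine ⟨ih.2, ?_⟩
    simp only [fastMixLoop]
    rw [average_sub, average_smul, average_smul, hW.average_mix, ih.1, ih.2]
    module

theorem IsMixingMatrix.average_fastMix (hW : IsMixingMatrix G W) (K : ℕ) (x : Stack m d) :
    average (fastMix W K x) = average x :=
  (hW.average_fastMixLoop x K).1

/-- A second-order linear recursion has a quadratic form that it multiplies by a constant. -/
theorem quadratic_form_recursion {E : Type*} [NormedAddCommGroup E] [InnerProductSpace ℝ E]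
    (p η : ℝ) (a b : E) :
    ‖p • b - η • a‖ ^ 2 - p * inner ℝ (p • b - η • a) b + η * ‖b‖ ^ 2
      = η * (‖b‖ ^ 2 - p * inner ℝ b a + η * ‖a‖ ^ 2) := by
  rw [norm_sub_sq_real, norm_smul, norm_smul, inner_sub_left, inner_smul_left, inner_smul_left,
    inner_smul_left, inner_smul_right, real_inner_self_eq_norm_sq, mul_pow, mul_pow,
    Real.norm_eq_abs, Real.norm_eq_abs, sq_abs, sq_abs, real_inner_comm b a]
  simp only [conj_trivial]
  ring

theorem quadratic_form_ge {E : Type*} [NormedAddCommGroup E] [InnerProductSpace ℝ E]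
    (p η : ℝ) (a b : E) :
    (η - p ^ 2 / 4) * ‖a‖ ^ 2 ≤ ‖b‖ ^ 2 - p * inner ℝ b a + η * ‖a‖ ^ 2 := by
  have h : 0 ≤ ‖b - (p / 2) • a‖ ^ 2 := by positivity
  rw [norm_sub_sq_real, norm_smul, inner_smul_right, mul_pow, Real.norm_eq_abs, sq_abs] at h
  nlinarith

/-- With η = 1/(1 + c) and p = (1 + η)t, the right side is three times the coefficient in
`quadratic_form_ge`, and the left side is 1 - p + η, the value of the form on two equal unit
vectors. So the lower bound degenerates no faster than the initial value, and the factor 3 is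
uniform in the spectrum. -/
theorem momentum_discriminant {l c t : ℝ} (hc0 : 0 < c) (hc1 : c ≤ 1) (hc : c ^ 2 = 1 - l ^ 2)
    (ht0 : 0 ≤ t) (htl : t ≤ l) (hl : l < 1) :
    (1 + 1 / (1 + c)) * (1 - t)
      ≤ 3 * (1 / (1 + c) - ((1 + 1 / (1 + c)) * t) ^ 2 / 4) := by
  have e1 : 1 + 1 / (1 + c) = (2 + c) / (1 + c) := by field_simp; ring
  rw [e1]
  suffices h : 4 * (2 + c) * (1 + c) * (1 - t) ≤ 3 * (4 * (1 + c) - (2 + c) ^ 2 * t ^ 2) by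
    have h2 : 3 * (1 / (1 + c) - ((2 + c) / (1 + c) * t) ^ 2 / 4) - (2 + c) / (1 + c) * (1 - t)
        = (3 * (4 * (1 + c) - (2 + c) ^ 2 * t ^ 2) - 4 * (2 + c) * (1 + c) * (1 - t))
          / (4 * (1 + c) ^ 2) := by field_simp
    have : 0 ≤ 3 * (1 / (1 + c) - ((2 + c) / (1 + c) * t) ^ 2 / 4)
        - (2 + c) / (1 + c) * (1 - t) := by
      rw [h2]; exact div_nonneg (by linarith) (by positivity)
    linarith
  -- the difference of the two sides is concave in `t`: it is enough to look at both ends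
  have h0 : 4 * (2 + c) * (1 + c) ≤ 12 * (1 + c) := by nlinarith
  have h1 : 4 * (2 + c) * (1 + c) * (1 - l) ≤ 3 * (4 * (1 + c) - (2 + c) ^ 2 * l ^ 2) := by
    have e : 3 * (4 * (1 + c) - (2 + c) ^ 2 * l ^ 2) = 3 * (c ^ 2 * (3 + c) * (1 + c)) := by
      rw [show l ^ 2 = 1 - c ^ 2 by linarith]; ring
    have hl2 : 1 - l ≤ c ^ 2 := by nlinarith
    rw [e]
    calc 4 * (2 + c) * (1 + c) * (1 - l) ≤ 4 * (2 + c) * (1 + c) * c ^ 2 := by gcongr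
      _ ≤ _ := by
        have : 0 ≤ c ^ 2 * (1 + c) * (1 - c) := by
          have := sub_nonneg.2 hc1
          positivity
        nlinarith
  rcases ht0.eq_or_lt with h | h
  · rw [← h]; linarith
  · have hl0 : 0 < l := h.trans_le htl
    have h3 : 0 ≤ (2 + c) ^ 2 * (t * (l - t)) := by
      have := sub_nonneg.2 htl
      positivity
    have h4 := mul_le_mul_of_nonneg_left h0 (sub_nonneg.2 htl)
    have h5 := mul_le_mul_of_nonneg_left h1 h.le
    refine le_of_mul_le_mul_left ?_ hl0
    nlinarith

theorem consensusErrorSq_fastMix_le_pow (hW : IsMixingMatrix G W) (hm : 2 ≤ m) (K : ℕ)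
    (x : Stack m d) :
    consensusErrorSq (fastMix W K x) ≤ 3 * etaW W ^ K * consensusErrorSq x := by
  obtain ⟨⟨hl0, hl1⟩, b, μ, i₀, hb, h₀, h⟩ := hW.exists_eigenbasis hm
  rw [consensusErrorSq_eq_sum_coeff (by omega) b h₀ fun i hi => (h i hi).2.2,
    consensusErrorSq_eq_sum_coeff (by omega) b h₀ fun i hi => (h i hi).2.2, Finset.mul_sum]
  refine Finset.sum_le_sum fun i hi => ?_
  obtain ⟨hμ0, hμl, -⟩ := h i (Finset.ne_of_mem_erase hi)
  have hc : √(1 - lambda2 W ^ 2) ^ 2 = 1 - lambda2 W ^ 2 := Real.sq_sqrt (by nlinarith)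
  have hc0 : 0 < √(1 - lambda2 W ^ 2) := Real.sqrt_pos.2 (by nlinarith)
  have hc1 : √(1 - lambda2 W ^ 2) ≤ 1 := Real.sqrt_le_one.2 (by nlinarith)
  have hdisc := momentum_discriminant hc0 hc1 hc hμ0 hμl hl1
  have hη0 : 0 < etaW W := by unfold etaW; positivity
  rw [← etaW] at hdisc
  set η := etaW W
  set p := (1 + η) * μ i with hp
  -- The form is multiplied by η at each pass; it starts at (1 + η)(1 - μ)‖·‖² because x⁰ = x¹.
  have hQ : ∀ k, ‖coeff (b i) (fastMixLoop W x k).cur‖ ^ 2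
      - p * inner ℝ (coeff (b i) (fastMixLoop W x k).cur) (coeff (b i) (fastMixLoop W x k).prev)
      + η * ‖coeff (b i) (fastMixLoop W x k).prev‖ ^ 2
      = η ^ k * ((1 + η) * (1 - μ i) * ‖coeff (b i) x‖ ^ 2) := by
    intro k
    induction k with
    | zero =>
      simp only [fastMixLoop, real_inner_self_eq_norm_sq]
      ring
    | succ k ih =>
      have e : coeff (b i) (fastMixLoop W x (k + 1)).cur
          = p • coeff (b i) (fastMixLoop W x k).cur
            - η • coeff (b i) (fastMixLoop W x k).prev := by
        simp only [fastMixLoop]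
        rw [coeff_sub, coeff_smul, coeff_smul, coeff_mix hW.symm (hb i), smul_smul]
      have e' : (fastMixLoop W x (k + 1)).prev = (fastMixLoop W x k).cur := rfl
      rw [e, e', quadratic_form_recursion, ih]
      ring
  have hge := quadratic_form_ge p η (coeff (b i) (fastMixLoop W x K).prev)
    (coeff (b i) (fastMixLoop W x K).cur)
  rw [hQ K] at hge
  change ‖coeff (b i) (fastMixLoop W x K).prev‖ ^ 2 ≤ _
  set q := ‖coeff (b i) (fastMixLoop W x K).prev‖ ^ 2
  have hq : 0 ≤ q := by positivity
  have hr : 0 < (1 + η) * (1 - μ i) := mul_pos (by linarith) (by linarith)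
  refine le_of_mul_le_mul_left ?_ hr
  have := mul_le_mul_of_nonneg_right hdisc hq
  calc (1 + η) * (1 - μ i) * q ≤ 3 * (η - p ^ 2 / 4) * q := this
    _ ≤ 3 * (η ^ K * ((1 + η) * (1 - μ i) * ‖coeff (b i) x‖ ^ 2)) := by linarith
    _ = _ := by ring

theorem etaW_pow_mixSteps_le (hl0 : 0 ≤ lambda2 W) (hl1 : lambda2 W < 1) :
    etaW W ^ mixSteps W ≤ 1 / 2 ^ 15 := by
  set u := √(1 - lambda2 W) with hu
  have hu0 : 0 < u := Real.sqrt_pos.2 (by linarith)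
  have hu1 : u ≤ 1 := Real.sqrt_le_one.2 (by linarith)
  have huc : u ≤ √(1 - lambda2 W ^ 2) := Real.sqrt_le_sqrt (by nlinarith)
  have h1 : etaW W ≤ (1 + u)⁻¹ := by
    rw [etaW, one_div]
    exact inv_anti₀ (by linarith) (by linarith)
  -- Bernoulli. Raised to the power 15 this gives 2⁻¹⁵, and 3/2¹⁵ < 1/10000.
  have h2 : (2 : ℝ) ≤ (1 + u) ^ u⁻¹ := by
    have := one_add_mul_self_le_rpow_one_add (s := u) (by linarith) (one_le_inv₀ hu0 |>.2 hu1)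
    rw [inv_mul_cancel₀ hu0.ne'] at this
    linarith
  have h3 : (2 : ℝ) ^ 15 ≤ (1 + u) ^ mixSteps W := by
    calc (2 : ℝ) ^ 15 ≤ ((1 + u) ^ u⁻¹) ^ 15 := by gcongr
      _ = (1 + u) ^ (15 / u) := by
        rw [← Real.rpow_natCast, ← Real.rpow_mul (by linarith)]
        congr 1
        push_cast
        ring
      _ ≤ (1 + u) ^ ((mixSteps W : ℕ) : ℝ) :=
        Real.rpow_le_rpow_of_exponent_le (by linarith) (Nat.le_ceil _)
      _ = _ := Real.rpow_natCast _ _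
  calc etaW W ^ mixSteps W ≤ ((1 + u)⁻¹) ^ mixSteps W := by
        have : 0 ≤ etaW W := by unfold etaW; positivity
        gcongr
    _ ≤ _ := by
        rw [inv_pow, one_div]
        exact inv_anti₀ (by positivity) h3

theorem consensusErrorSq_fastMix_le (hW : IsMixingMatrix G W) (hm : 2 ≤ m) (x : Stack m d) :
    consensusErrorSq (fastMix W (mixSteps W) x) ≤ 1 / 10000 * consensusErrorSq x := by
  obtain ⟨⟨hl0, hl1⟩, -⟩ := hW.exists_eigenbasis hm
  refine (consensusErrorSq_fastMix_le_pow hW hm _ x).trans ?_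
  have := etaW_pow_mixSteps_le hl0 hl1
  refine mul_le_mul_of_nonneg_right ?_ (consensusErrorSq_nonneg x)
  norm_num at this ⊢
  linarith

theorem mixSteps_le (hl0 : 0 ≤ lambda2 W) (hl1 : lambda2 W < 1) :
    (mixSteps W : ℝ) ≤ 16 / √(1 - lambda2 W) := by
  have hu0 : 0 < √(1 - lambda2 W) := Real.sqrt_pos.2 (by linarith)
  have hu1 : √(1 - lambda2 W) ≤ 1 := Real.sqrt_le_one.2 (by linarith)
  have h1 : 1 ≤ 1 / √(1 - lambda2 W) := by rwa [le_div_iff₀ hu0, one_mul]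
  have h2 := (Nat.ceil_lt_add_one (show 0 ≤ 15 / √(1 - lambda2 W) by positivity)).le
  calc (mixSteps W : ℝ) ≤ 15 / √(1 - lambda2 W) + 1 := h2
    _ ≤ 15 / √(1 - lambda2 W) + 1 / √(1 - lambda2 W) := by gcongr
    _ = _ := by ring

end FastMix

/-! ### The Lyapunov function and its decrease. -/

section Energy

variable {m d : ℕ} {W : Matrix (Fin m) (Fin m) ℝ} {G : SimpleGraph (Fin m)}
  {f : Fin m → Vec d → ℝ} {g : Vec d → ℝ} {L : ℝ}

/-- The estimate of a proximal step of all agents, summed over the agents. -/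
theorem aggProx_average_le (hm : 0 < m) (hg : ConvexOn ℝ Set.univ g) {γ : ℝ} (hγ : 0 ≤ γ)
    (z s : Stack m d) (u : Vec d) :
    γ * g (average (aggProx γ g (z - γ • s)))
      + γ * inner ℝ (average s) (average (aggProx γ g (z - γ • s)) - u)
      + 1 / 2 * ‖average (aggProx γ g (z - γ • s)) - average z‖ ^ 2
      + 1 / 2 * ‖average (aggProx γ g (z - γ • s)) - u‖ ^ 2
      + (m : ℝ)⁻¹ * (1 / 4 * consensusErrorSq (aggProx γ g (z - γ • s)))
    ≤ γ * g u + 1 / 2 * ‖average z - u‖ ^ 2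
      + (m : ℝ)⁻¹ * (1 / 2 * consensusErrorSq z + γ ^ 2 * consensusErrorSq s) := by
  set w := aggProx γ g (z - γ • s) with hw
  have hm' : (0 : ℝ) < m := by exact_mod_cast hm
  have h1 : ∀ i, γ * g (w i) + γ * inner ℝ (s i) (w i - u) + 1 / 2 * ‖(w - z) i‖ ^ 2
      + 1 / 2 * ‖w i - u‖ ^ 2 ≤ γ * g u + 1 / 2 * ‖z i - u‖ ^ 2 := by
    intro i
    have h := (isProx_prox hg hγ ((z - γ • s) i)).add_sq_norm_sub_le hg hγ u
    change γ * g (w i) + 1 / 2 * ‖w i - (z i - γ • s i)‖ ^ 2 + 1 / 2 * ‖u - w i‖ ^ 2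
      ≤ γ * g u + 1 / 2 * ‖u - (z i - γ • s i)‖ ^ 2 at h
    rw [show w i - (z i - γ • s i) = (w i - z i) + γ • s i by abel,
      show u - (z i - γ • s i) = (u - z i) + γ • s i by abel, norm_add_sq_real, norm_add_sq_real,
      inner_smul_right, inner_smul_right, norm_sub_rev u, norm_sub_rev u] at h
    have e : inner ℝ (w i - z i) (s i) - inner ℝ (u - z i) (s i) = inner ℝ (s i) (w i - u) := by
      rw [← inner_sub_left, sub_sub_sub_cancel_right, real_inner_comm]
    rw [← e, Pi.sub_apply]
    linarith
  -- Young's inequality, weighted so that half of the consensus error of `w` on the left survives;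
  -- it later pays for the new `z`.
  have h2 : ∀ i, - (γ * inner ℝ (s i - average s) (w i - average w))
      ≤ γ ^ 2 * ‖s i - average s‖ ^ 2 + 1 / 4 * ‖w i - average w‖ ^ 2 := by
    intro i
    have : 0 ≤ ‖γ • (s i - average s) + (1 / 2 : ℝ) • (w i - average w)‖ ^ 2 := by positivity
    rw [norm_add_sq_real, norm_smul, norm_smul, inner_smul_left, inner_smul_right, mul_pow,
      mul_pow, Real.norm_eq_abs, Real.norm_eq_abs, sq_abs, sq_abs] at this
    simp only [conj_trivial] at this
    linarith
  have h1' := Finset.sum_le_sum fun i (_ : i ∈ Finset.univ) => h1 i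
  have h2' := Finset.sum_le_sum fun i (_ : i ∈ Finset.univ) => h2 i
  -- Jensen: averaging does not commute with the proximal map, but only this inequality is needed.
  have hJ : (m : ℝ) * g (average w) ≤ ∑ i, g (w i) := by
    have h := hg.map_sum_le (t := Finset.univ) (w := fun _ => (m : ℝ)⁻¹) (p := w)
      (fun _ _ => by positivity) (by simp [hm'.ne']) (fun _ _ => Set.mem_univ _)
    rw [← Finset.smul_sum, ← Finset.smul_sum, smul_eq_mul] at h
    calc (m : ℝ) * g (average w) ≤ m * ((m : ℝ)⁻¹ * ∑ i, g (w i)) := by gcongr; exact h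
      _ = _ := by field_simp
  have hJ' := mul_le_mul_of_nonneg_left hJ hγ
  have hwz : (m : ℝ) * ‖average w - average z‖ ^ 2 ≤ ∑ i, ‖(w - z) i‖ ^ 2 := by
    have := sum_sq_norm_sub hm (w - z) 0
    simp only [sub_zero, average_sub] at this
    rw [this]
    linarith [consensusErrorSq_nonneg (w - z)]
  simp only [Finset.sum_add_distrib, ← Finset.mul_sum, Finset.sum_neg_distrib, Finset.sum_const,
    Finset.card_univ, Fintype.card_fin, nsmul_eq_mul] at h1' h2'
  rw [sum_inner_sub hm, sum_sq_norm_sub hm, sum_sq_norm_sub hm] at h1'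
  change _ ≤ γ ^ 2 * consensusErrorSq s + 1 / 4 * consensusErrorSq w at h2'
  refine le_of_mul_le_mul_left ?_ hm'
  simp only [mul_add, mul_inv_cancel_left₀ hm'.ne']
  linarith

/-- The estimate of the smooth part `(1/m) ∑ fᵢ` at a convex combination, from the local gradients
at the rows of `x`. -/
theorem smooth_average_le (hm : 0 < m) (hL : 0 < L) (hf : ∀ i, IsConvexSmooth L (f i)) {τ : ℝ}
    (hτ0 : 0 ≤ τ) (hτ1 : τ ≤ 1) (x : Stack m d) (y z u : Vec d) :
    (m : ℝ)⁻¹ * ∑ i, f i (τ • z + (1 - τ) • y)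
      ≤ (1 - τ) * ((m : ℝ)⁻¹ * ∑ i, f i y)
        + τ * ((m : ℝ)⁻¹ * ∑ i, f i u + inner ℝ (average (aggGradient f x)) (z - u))
        + L / 2 * ((m : ℝ)⁻¹ * ∑ i, ‖x i - (τ • z + (1 - τ) • y)‖ ^ 2)
        - (1 - τ) / (2 * L) * ((m : ℝ)⁻¹ * ∑ i, ‖gradient (f i) y - aggGradient f x i‖ ^ 2) := by
  have hm' : (0 : ℝ) < m := by exact_mod_cast hm
  have h : ∀ i, f i (τ • z + (1 - τ) • y) ≤ (1 - τ) * f i y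
      + τ * (f i u + inner ℝ (aggGradient f x i) (z - u))
      + L / 2 * ‖x i - (τ • z + (1 - τ) • y)‖ ^ 2
      - (1 - τ) / (2 * L) * ‖gradient (f i) y - aggGradient f x i‖ ^ 2 := by
    intro i
    have h1 := (hf i).upper (x i) (τ • z + (1 - τ) • y)
    have h2 := mul_le_mul_of_nonneg_left ((hf i).add_sq_norm_gradient_sub_le hL (x i) y)
      (sub_nonneg.2 hτ1)
    have h3 := mul_le_mul_of_nonneg_left ((hf i).lower (x i) u) hτ0
    -- The displacement is (1 - τ)(y - xᵢ) + τ(u - xᵢ) + τ(z - u), matching the two lower bounds at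
    -- `y` and `u`.
    have e : inner ℝ (gradient (f i) (x i)) (τ • z + (1 - τ) • y - x i)
        = (1 - τ) * inner ℝ (gradient (f i) (x i)) (y - x i)
          + τ * inner ℝ (gradient (f i) (x i)) (u - x i)
          + τ * inner ℝ (gradient (f i) (x i)) (z - u) := by
      simp only [← inner_smul_right_eq_smul, ← smul_eq_mul (a := τ), ← smul_eq_mul (a := 1 - τ),
        ← inner_add_right]
      congr 1
      module
    rw [e] at h1
    simp only [aggGradient]
    have e2 : (1 - τ) / (2 * L) * ‖gradient (f i) y - gradient (f i) (x i)‖ ^ 2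
        = (1 - τ) * (1 / (2 * L) * ‖gradient (f i) y - gradient (f i) (x i)‖ ^ 2) := by ring
    rw [e2]
    linarith
  have h' := Finset.sum_le_sum fun i (_ : i ∈ Finset.univ) => h i
  simp only [Finset.sum_add_distrib, Finset.sum_sub_distrib, ← Finset.mul_sum, ← sum_inner] at h'
  rw [← smul_average hm, inner_smul_left] at h'
  simp only [conj_trivial] at h'
  refine le_of_mul_le_mul_left ?_ hm'
  have c : ∀ a b : ℝ, (m : ℝ) * (a * ((m : ℝ)⁻¹ * b)) = a * b := fun a b => by field_simp
  simp only [mul_add, mul_sub, c, mul_inv_cancel_left₀ hm'.ne'] at h' ⊢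
  linarith

/-- The mean square deviation of the rows of `x` from `v`. -/
def meanSqDist (x : Stack m d) (v : Vec d) : ℝ := (m : ℝ)⁻¹ * ∑ i, ‖x i - v‖ ^ 2

/-- The Lyapunov function of the method, with the weight `a` of the suboptimality. -/
def energy (f : Fin m → Vec d → ℝ) (g : Vec d → ℝ) (L : ℝ) (u : Vec d) (a : ℝ)
    (st : State m d) : ℝ :=
  a * (objective f g (average st.y) - objective f g u) + 100 * L * ‖average st.z - u‖ ^ 2
    + 103 * L * ((m : ℝ)⁻¹ * consensusErrorSq st.z)
    + 5 * L * (a * ((m : ℝ)⁻¹ * consensusErrorSq st.y))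
    + a * ((m : ℝ)⁻¹ * consensusErrorSq st.s) / L
    + L * (a * meanSqDist st.x (average st.y))

/-- The gradients are those at `x`, and `s` tracks their average. -/
structure IsTracking (f : Fin m → Vec d → ℝ) (st : State m d) : Prop where
  grad_eq : st.grad = aggGradient f st.x
  average_s : average st.s = average st.grad

/-- `FastMix` preserves averages, so the gradient increments telescope. -/
theorem IsTracking.step (hW : IsMixingMatrix G W) {st : State m d} (h : IsTracking f st) (K : ℕ)
    (γ τ : ℝ) : IsTracking f (step f g W K γ τ st) where
  grad_eq := rfl
  average_s := by
    simp only [Decentralized.step]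
    rw [hW.average_fastMix, average_sub, average_add, h.average_s, add_sub_cancel_left]

/-- The scalar bookkeeping of one iteration; primes mark new values. U is ‖z̄ - u‖², D is ‖z̄' -
z̄‖², V, X, Y, Z, S are mean consensus errors of the proximal output, the new `x`, `y`, `z`, `s`, R
is the distance from `x` to ȳ, and B the gradient change paid by cocoercivity. The weights balance
as follows: D + bX occurs with factor 3/2, and bX ≤ 2Z + 2bY. This adds 3 to the 100 that the
proximal step puts on Z, hence 103; on Y it gives 3·25/16 < 5. -/
theorem energy_arith {L a b τ γ δ δ' U U' D V X Y Z S R Y' Z' S' R' B : ℝ} (hL : 0 < L)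
    (hδ : 0 ≤ δ) (hτ0 : 0 < τ) (hb : b * τ ^ 2 = 1) (hba : b * (1 - τ) ≤ a)
    (hba' : b ≤ 25 / 16 * a) (hτ : 3 / 5 ≤ 1 - τ) (hγ : γ * τ * (200 * L) = 1)
    (hB : 0 ≤ B) (hR : 0 ≤ R) (hV : 0 ≤ V) (hY : 0 ≤ Y) (hS : 0 ≤ S) (hD : 0 ≤ D)
    (hX : X ≤ 2 * (τ ^ 2 * Z) + 2 * ((1 - τ) ^ 2 * Y))
    (hS' : S' ≤ 1 / 10000 * (2 * S + 2 * (2 * B + 2 * (L ^ 2 * R))))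
    (hZ' : Z' ≤ 1 / 10000 * V)
    (hY' : Y' ≤ 1 / 10000 * (2 * (τ ^ 2 * Z') + 2 * ((1 - τ) ^ 2 * Y)))
    (hR' : R' ≤ τ ^ 2 * D + X)
    (hmain : γ * δ' + τ * (1 / 2 * D + 1 / 2 * U' + 1 / 4 * V)
      ≤ γ * ((1 - τ) * δ + L / 2 * (τ ^ 2 * D + X) - (1 - τ) / (2 * L) * B)
        + τ * (1 / 2 * U + 1 / 2 * Z + γ ^ 2 * S')) :
    b * δ' + 100 * L * U' + 103 * L * Z' + 5 * L * (b * Y') + b * S' / L + L * (b * R')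
      ≤ a * δ + 100 * L * U + 103 * L * Z + 5 * L * (a * Y) + a * S / L + L * (a * R) := by
  have hb0 : 0 < b := by
    by_contra h
    nlinarith [sq_nonneg τ]
  have ha0 : 0 < a := by linarith
  have hγb : γ = b * τ / (200 * L) := by
    field_simp
    have : γ * (200 * L) * τ = b * τ * τ := by linarith
    have := mul_right_cancel₀ hτ0.ne' this
    linarith
  have hγ0 : 0 < γ := by rw [hγb]; positivity
  -- the main inequality, multiplied by `200 L / τ`
  have hmain' : b * δ' + 100 * L * D + 100 * L * U' + 50 * L * V
      ≤ b * (1 - τ) * δ + L / 2 * (D + b * X) - b * (1 - τ) / (2 * L) * B + 100 * L * U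
        + 100 * L * Z + b * S' / L / 200 := by
    have h := mul_le_mul_of_nonneg_left hmain (show 0 ≤ 200 * L / τ by positivity)
    have e1 : 200 * L / τ * γ = b := by rw [hγb]; field_simp
    have e2 : 200 * L / τ * τ = 200 * L := by field_simp
    have e3 : 200 * L * γ ^ 2 = b / L / 200 := by
      calc 200 * L * γ ^ 2 = b * (b * τ ^ 2) / L / 200 := by rw [hγb]; field_simp
        _ = _ := by rw [hb, mul_one]
    rw [mul_add (200 * L / τ), mul_add (200 * L / τ), ← mul_assoc _ γ, ← mul_assoc _ γ, ← mul_assoc _ τ, ← mul_assoc _ τ, e1,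
      e2] at h
    have e4 : 200 * L * (1 / 2 * U + 1 / 2 * Z + γ ^ 2 * S')
        = 100 * L * U + 100 * L * Z + b * S' / L / 200 := by
      calc _ = 100 * L * U + 100 * L * Z + 200 * L * γ ^ 2 * S' := by ring
        _ = _ := by rw [e3]; ring
    have e5 : b * ((1 - τ) * δ + L / 2 * (τ ^ 2 * D + X) - (1 - τ) / (2 * L) * B)
        = b * (1 - τ) * δ + L / 2 * (b * τ ^ 2 * D + b * X) - b * (1 - τ) / (2 * L) * B := by ring
    rw [e4, e5, hb] at h
    linarith
  have hsq : (1 - τ) ^ 2 ≤ 1 := by nlinarith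
  have hbX : b * X ≤ 2 * Z + 2 * (b * Y) := by
    calc b * X ≤ b * (2 * (τ ^ 2 * Z) + 2 * (1 * Y)) := by
          gcongr; exact hX.trans (by gcongr)
      _ = 2 * (b * τ ^ 2 * Z) + 2 * (b * Y) := by ring
      _ = _ := by rw [hb, one_mul]
  have hbY' : b * Y' ≤ 1 / 10000 * (2 * Z' + 2 * (b * Y)) := by
    calc b * Y' ≤ b * (1 / 10000 * (2 * (τ ^ 2 * Z') + 2 * (1 * Y))) := by
          gcongr; exact hY'.trans (by gcongr)
      _ = 1 / 10000 * (2 * (b * τ ^ 2 * Z') + 2 * (b * Y)) := by ring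
      _ = _ := by rw [hb, one_mul]
  have hbR' : b * R' ≤ D + b * X := by
    calc b * R' ≤ b * (τ ^ 2 * D + X) := by gcongr
      _ = b * τ ^ 2 * D + b * X := by ring
      _ = _ := by rw [hb, one_mul]
  have hbY : b * Y ≤ 25 / 16 * (a * Y) := by
    calc _ ≤ 25 / 16 * a * Y := by gcongr
      _ = _ := by ring
  have hbR : b * R ≤ 25 / 16 * (a * R) := by
    calc _ ≤ 25 / 16 * a * R := by gcongr
      _ = _ := by ring
  have hbS : b * S / L ≤ 25 / 16 * (a * S / L) := by
    calc _ ≤ 25 / 16 * a * S / L := by gcongr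
      _ = _ := by ring
  have hbS' : b * S' / L ≤ 1 / 10000 * (2 * (b * S / L) + 2 * (2 * (b * B / L)
      + 2 * (L * (b * R)))) := by
    calc b * S' / L ≤ b * (1 / 10000 * (2 * S + 2 * (2 * B + 2 * (L ^ 2 * R)))) / L := by gcongr
      _ = _ := by field_simp
  have hdδ : b * (1 - τ) * δ ≤ a * δ := by gcongr
  have hdB : 3 / 10 * (b * B / L) ≤ b * (1 - τ) / (2 * L) * B := by
    calc 3 / 10 * (b * B / L) = b * (3 / 5) / (2 * L) * B := by ring
      _ ≤ _ := by gcongr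
  have haY : 0 ≤ a * Y := by positivity
  have haR : 0 ≤ L * (a * R) := by positivity
  have haS : 0 ≤ a * S / L := by positivity
  have hbB : 0 ≤ b * B / L := by positivity
  have hLbR : L * (b * R) ≤ 25 / 16 * (L * (a * R)) := by
    calc _ ≤ L * (25 / 16 * (a * R)) := by gcongr
      _ = _ := by ring
  -- the terms that carry the factor `L`
  have hcons : L * (1 / 2 * (D + b * X) + 103 * Z' + 5 * (b * Y') + b * R')
      ≤ L * (100 * D + 50 * V + 3 * Z + 5 * (a * Y)) := by
    gcongr ?_ * ?_
    linarith
  linarith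

/-- One iteration does not increase the Lyapunov function. -/
theorem energy_step_le (hW : IsMixingMatrix G W) (hm : 2 ≤ m) (hL : 0 < L)
    (hf : ∀ i, IsConvexSmooth L (f i)) (hg : ConvexOn ℝ Set.univ g) {u : Vec d}
    (hu : ∀ v, objective f g u ≤ objective f g v) {a b τ γ : ℝ} (hτ0 : 0 < τ)
    (hb : b * τ ^ 2 = 1) (hba : b * (1 - τ) ≤ a) (hba' : b ≤ 25 / 16 * a) (hτ : 3 / 5 ≤ 1 - τ)
    (hγ : γ * τ * (200 * L) = 1) {st : State m d} (hst : IsTracking f st) :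
    energy f g L u b (step f g W (mixSteps W) γ τ st) ≤ energy f g L u a st := by
  have hm0 : 0 < m := by omega
  have hm' : (0 : ℝ) < m := by exact_mod_cast hm0
  have hγ0 : 0 < γ := by
    by_contra h
    have : γ * τ * (200 * L) ≤ 0 :=
      mul_nonpos_of_nonpos_of_nonneg (mul_nonpos_of_nonpos_of_nonneg (not_lt.1 h) hτ0.le)
        (by positivity)
    linarith
  have hst' := hst.step hW (mixSteps W) γ τ (g := g)
  set st' := step f g W (mixSteps W) γ τ st with hdef
  have hx' : st'.x = τ • st.z + (1 - τ) • st.y := rfl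
  have hs' : st'.s = fastMix W (mixSteps W) (st.s + (st'.grad - st.grad)) := by
    rw [← add_sub_assoc]; rfl
  set w := aggProx γ g (st.z - γ • st'.s) with hw
  have hz' : st'.z = fastMix W (mixSteps W) w := rfl
  have hy' : st'.y = fastMix W (mixSteps W) (τ • st'.z + (1 - τ) • st.y) := rfl
  have ax : average st'.x = τ • average st.z + (1 - τ) • average st.y := by
    rw [hx', average_add, average_smul, average_smul]
  have az : average st'.z = average w := by rw [hz', hW.average_fastMix]
  have ay : average st'.y = τ • average st'.z + (1 - τ) • average st.y := by
    rw [hy', hW.average_fastMix, average_add, average_smul, average_smul]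
  have aS : average st'.s = average (aggGradient f st'.x) := by
    rw [hst'.average_s, hst'.grad_eq]
  have hM : (0 : ℝ) ≤ (m : ℝ)⁻¹ := by positivity
  have hdev : meanSqDist st'.x (average st'.y)
      = τ ^ 2 * ‖average st'.z - average st.z‖ ^ 2 + (m : ℝ)⁻¹ * consensusErrorSq st'.x := by
    rw [meanSqDist, sum_sq_norm_sub hm0, mul_add, inv_mul_cancel_left₀ hm'.ne', ax, ay,
      add_sub_add_right_eq_sub, ← smul_sub, norm_smul, mul_pow, Real.norm_eq_abs, sq_abs,
      norm_sub_rev]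
  have hdelta : 0 ≤ objective f g (average st.y) - objective f g u := sub_nonneg.2 (hu _)
  have hX : consensusErrorSq st'.x
      ≤ 2 * (τ ^ 2 * consensusErrorSq st.z) + 2 * ((1 - τ) ^ 2 * consensusErrorSq st.y) := by
    rw [hx', ← consensusErrorSq_smul, ← consensusErrorSq_smul]
    exact consensusErrorSq_add_le _ _
  have hY' : consensusErrorSq st'.y ≤ 1 / 10000 * (2 * (τ ^ 2 * consensusErrorSq st'.z)
      + 2 * ((1 - τ) ^ 2 * consensusErrorSq st.y)) := by
    rw [hy', ← consensusErrorSq_smul, ← consensusErrorSq_smul]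
    refine (consensusErrorSq_fastMix_le hW hm _).trans ?_
    gcongr
    exact consensusErrorSq_add_le _ _
  have hZ' : consensusErrorSq st'.z ≤ 1 / 10000 * consensusErrorSq w := by
    rw [hz']; exact consensusErrorSq_fastMix_le hW hm _
  -- Both gradients are compared with the gradient at the old average of `y`.
  have hgrad : consensusErrorSq (st'.grad - st.grad)
      ≤ 2 * ∑ i, ‖gradient (f i) (average st.y) - aggGradient f st'.x i‖ ^ 2
        + 2 * (L ^ 2 * ∑ i, ‖st.x i - average st.y‖ ^ 2) := by
    refine (consensusErrorSq_le_sum hm0 _).trans ?_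
    rw [Finset.mul_sum, Finset.mul_sum, Finset.mul_sum, ← Finset.sum_add_distrib]
    refine Finset.sum_le_sum fun i _ => ?_
    rw [hst'.grad_eq, hst.grad_eq, Pi.sub_apply, ← sub_add_sub_cancel _
      (gradient (f i) (average st.y)), norm_sub_rev (gradient (f i) (average st.y))]
    refine (sq_norm_add_le _ _).trans ?_
    gcongr
    rw [norm_sub_rev]
    exact (hf i).sq_norm_gradient_sub_le hL _ _
  have hS' : consensusErrorSq st'.s ≤ 1 / 10000 * (2 * consensusErrorSq st.s
      + 2 * (2 * ∑ i, ‖gradient (f i) (average st.y) - aggGradient f st'.x i‖ ^ 2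
        + 2 * (L ^ 2 * ∑ i, ‖st.x i - average st.y‖ ^ 2))) := by
    rw [hs']
    refine (consensusErrorSq_fastMix_le hW hm _).trans ?_
    gcongr
    refine (consensusErrorSq_add_le _ _).trans ?_
    gcongr
  have hprox := mul_le_mul_of_nonneg_left
    (aggProx_average_le hm0 hg hγ0.le st.z st'.s u) hτ0.le
  rw [← hw, ← az, aS] at hprox
  have hsm := mul_le_mul_of_nonneg_left
    (smooth_average_le hm0 hL hf hτ0.le (by linarith) st'.x (average st.y) (average st'.z) u)
    hγ0.le
  rw [← ay, ← meanSqDist, hdev] at hsm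
  have hcv := mul_le_mul_of_nonneg_left (hg.2 (Set.mem_univ (average st'.z))
    (Set.mem_univ (average st.y)) hτ0.le (by linarith : (0 : ℝ) ≤ 1 - τ) (by ring)) hγ0.le
  rw [← ay, smul_eq_mul, smul_eq_mul] at hcv
  have key := fun {p q : ℝ} (h : p ≤ q) => mul_le_mul_of_nonneg_left h hM
  refine energy_arith (V := (m : ℝ)⁻¹ * consensusErrorSq w)
    (D := ‖average st'.z - average st.z‖ ^ 2) (X := (m : ℝ)⁻¹ * consensusErrorSq st'.x)
    (B := (m : ℝ)⁻¹ * ∑ i, ‖gradient (f i) (average st.y) - aggGradient f st'.x i‖ ^ 2)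
    hL hdelta hτ0 hb hba hba' hτ hγ ?_ ?_ ?_ ?_ ?_ (by positivity) ?_ ?_ ?_ ?_ hdev.le ?_
  · positivity
  · unfold meanSqDist; positivity
  · exact mul_nonneg hM (consensusErrorSq_nonneg _)
  · exact mul_nonneg hM (consensusErrorSq_nonneg _)
  · exact mul_nonneg hM (consensusErrorSq_nonneg _)
  · linarith [key hX]
  · unfold meanSqDist; linarith [key hS']
  · linarith [key hZ']
  · linarith [key hY']
  · simp only [objective]
    linarith

end Energy

/-! ### Cost counts and the convergence rate. -/

section Rate

variable {m d : ℕ} {W : Matrix (Fin m) (Fin m) ℝ} {G : SimpleGraph (Fin m)}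
  {f : Fin m → Vec d → ℝ} {g : Vec d → ℝ} {L : ℝ}

theorem isTracking_convexRun (hW : IsMixingMatrix G W) (x₁ : Vec d) (n : ℕ) :
    IsTracking f (convexRun f g W L x₁ n) := by
  induction n with
  | zero => exact ⟨rfl, rfl⟩
  | succ n ih => exact ih.step hW _ _ _

theorem gradCalls_convexRun (x₁ : Vec d) (n : ℕ) :
    (convexRun f g W L x₁ n).gradCalls = n + 1 := by
  induction n with
  | zero => rfl
  | succ n ih => exact congrArg (· + 1) ih

theorem rounds_convexRun (x₁ : Vec d) (n : ℕ) :
    (convexRun f g W L x₁ n).rounds = 3 * mixSteps W * n := by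
  induction n with
  | zero => rfl
  | succ n ih =>
    change (convexRun f g W L x₁ n).rounds + fastMixRounds _ _ _ + fastMixRounds _ _ _
      + fastMixRounds _ _ _ = _
    rw [ih, fastMixRounds_eq, fastMixRounds_eq, fastMixRounds_eq]
    ring

theorem energy_convexRun_le (hW : IsMixingMatrix G W) (hm : 2 ≤ m) (hL : 0 < L)
    (hf : ∀ i, IsConvexSmooth L (f i)) (hg : ConvexOn ℝ Set.univ g) {u : Vec d}
    (hu : ∀ v, objective f g u ≤ objective f g v) (x₁ : Vec d) (n : ℕ) :
    energy f g L u (((n : ℝ) + 4) ^ 2 / 4) (convexRun f g W L x₁ n)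
      ≤ energy f g L u 4 (initState f x₁) := by
  induction n with
  | zero => exact le_of_eq (by norm_num [convexRun, odapg])
  | succ n ih =>
    refine le_trans ?_ ih
    have hn : (0 : ℝ) ≤ n := n.cast_nonneg
    -- Here τ = 2/(n + 5), so b = (n + 5)²/4. The conditions become (n + 5)(n + 3) ≤ (n + 4)², and
    -- two bounds, 25/16 and 3/5, that are attained at n = 0.
    refine energy_step_le hW hm hL hf hg hu ?_ ?_ ?_ ?_ ?_ ?_ (isTracking_convexRun hW x₁ n)
    all_goals try simp only [weight, stepSize, Nat.cast_add, Nat.cast_one]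
    · positivity
    · field_simp
      norm_num
    · have : ((n : ℝ) + 1 + 4) ^ 2 / 4 * (1 - 2 / (n + 1 + 4)) = (n + 5) * (n + 3) / 4 := by
        field_simp; ring
      rw [this]
      nlinarith
    · nlinarith
    · have : 2 / ((n : ℝ) + 1 + 4) ≤ 2 / 5 := by gcongr; linarith
      linarith
    · field_simp

theorem energy_initState_le (hm : 0 < m) (hL : 0 < L) {u x₁ : Vec d} {Δ D S : ℝ}
    (hΔ : objective f g x₁ - objective f g u ≤ Δ) (hD : ‖x₁ - u‖ ≤ D)
    (hS : consensusErrorSq (aggGradient f fun _ => x₁) ≤ S) :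
    energy f g L u 4 (initState f x₁) ≤ 4 * Δ + 100 * L * D ^ 2 + 4 * S / L := by
  have hM : (m : ℝ)⁻¹ ≤ 1 := inv_le_one_of_one_le₀ (by exact_mod_cast hm)
  have hS' : (m : ℝ)⁻¹ * consensusErrorSq (aggGradient f fun _ => x₁) ≤ S :=
    (mul_le_of_le_one_left (consensusErrorSq_nonneg _) hM).trans hS
  simp only [energy, initState, meanSqDist, average_const hm, consensusErrorSq_const hm, sub_self,
    norm_zero]
  have h1 : 100 * L * ‖x₁ - u‖ ^ 2 ≤ 100 * L * D ^ 2 := by gcongr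
  have h2 : 4 * ((m : ℝ)⁻¹ * consensusErrorSq (aggGradient f fun _ => x₁)) / L ≤ 4 * S / L := by
    gcongr
  simp only [ne_eq, OfNat.ofNat_ne_zero, not_false_eq_true, zero_pow, Finset.sum_const_zero,
    mul_zero, add_zero]
  linarith

theorem mul_suboptimality_le_energy (hL : 0 < L) {u : Vec d} {a : ℝ} (ha : 0 ≤ a)
    (st : State m d) :
    a * (objective f g (average st.y) - objective f g u) ≤ energy f g L u a st := by
  have h1 := consensusErrorSq_nonneg st.z
  have h2 := consensusErrorSq_nonneg st.y
  have h3 := consensusErrorSq_nonneg st.s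
  unfold energy meanSqDist
  have h4 : 0 ≤ 100 * L * ‖average st.z - u‖ ^ 2 := by positivity
  have h5 : 0 ≤ 103 * L * ((m : ℝ)⁻¹ * consensusErrorSq st.z) := by positivity
  have h6 : 0 ≤ 5 * L * (a * ((m : ℝ)⁻¹ * consensusErrorSq st.y)) := by positivity
  have h7 : 0 ≤ a * ((m : ℝ)⁻¹ * consensusErrorSq st.s) / L := by positivity
  have h8 : 0 ≤ L * (a * ((m : ℝ)⁻¹ * ∑ i, ‖st.x i - average st.y‖ ^ 2)) := by positivity
  linarith

/-- The `O(1 / n²)` rate of the method. -/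
theorem suboptimality_convexRun_le (hW : IsMixingMatrix G W) (hm : 2 ≤ m) (hL : 0 < L)
    (hf : ∀ i, IsConvexSmooth L (f i)) (hg : ConvexOn ℝ Set.univ g) {u x₁ : Vec d}
    (hu : ∀ v, objective f g u ≤ objective f g v) {Δ D S : ℝ}
    (hΔ : objective f g x₁ - objective f g u ≤ Δ) (hD : ‖x₁ - u‖ ≤ D)
    (hS : consensusErrorSq (aggGradient f fun _ => x₁) ≤ S) (n : ℕ) :
    ((n : ℝ) + 4) ^ 2 / 4
        * (objective f g (average (convexRun f g W L x₁ n).y) - objective f g u)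
      ≤ 4 * Δ + 100 * L * D ^ 2 + 4 * S / L :=
  (mul_suboptimality_le_energy hL (by positivity) _).trans <|
    (energy_convexRun_le hW hm hL hf hg hu x₁ n).trans
      (energy_initState_le (by omega) hL hΔ hD hS)

end Rate

end Decentralized

end

/-! ### The complexity bounds. -/

open Decentralized in
theorem corollary2 (L : ℝ) (hL : 0 < L) (Δ D S : ℝ) :
    ∃ c₁ > 0, ∃ c₂ > 0, ∀ (m d : ℕ) (_ : 2 ≤ m)
      (G : SimpleGraph (Fin m)) (W : Matrix (Fin m) (Fin m) ℝ) (_ : IsMixingMatrix G W)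
      (f : Fin m → Vec d → ℝ) (_ : ∀ i, IsConvexSmooth L (f i))
      (g : Vec d → ℝ) (_ : ConvexOn ℝ Set.univ g)
      (xstar : Vec d) (_ : ∀ x, objective f g xstar ≤ objective f g x)
      (x₁ : Vec d) (_ : objective f g x₁ - objective f g xstar ≤ Δ) (_ : ‖x₁ - xstar‖ ≤ D)
      (_ : consensusErrorSq (aggGradient f fun _ => x₁) ≤ S)
      (ε : ℝ) (_ : 0 < ε) (_ : ε ≤ 1),
      ∃ T : ℕ,
        (∀ n ≥ T, objective f g (average (convexRun f g W L x₁ n).y) - objective f g xstar ≤ ε) ∧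
        ((convexRun f g W L x₁ T).gradCalls : ℝ) ≤ c₁ / √ε ∧
        ((convexRun f g W L x₁ T).rounds : ℝ) ≤ c₂ / √(ε * (1 - lambda2 W)) := by
  set E := 4 * Δ + 100 * L * D ^ 2 + 4 * S / L with hE
  -- The rate gives suboptimality at most 4E/(n + 4)², so n ≥ C/√ε suffices. The absolute value is
  -- there because no sign of Δ or S is assumed at this point.
  set C := 2 * √|E| with hC
  have hC0 : 0 ≤ C := by positivity
  have hC2 : 4 * E ≤ C ^ 2 := by
    rw [hC, mul_pow, Real.sq_sqrt (abs_nonneg _)]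
    linarith [le_abs_self E]
  -- Rounding T up and the initial gradient each cost at most 1/√ε, as ε ≤ 1. Three calls of
  -- `FastMix`, each of at most 16/√(1 - λ₂) rounds, give 48.
  refine ⟨C + 2, by positivity, 48 * (C + 1), by positivity, ?_⟩
  intro m d hm G W hW f hf g hg xstar hmin x₁ hΔ hD hS ε hε hε1
  obtain ⟨⟨hl0, hl1⟩, -⟩ := hW.exists_eigenbasis hm
  have hs0 : 0 < √ε := Real.sqrt_pos.2 hε
  have hs1 : 1 ≤ 1 / √ε := by rw [le_div_iff₀ hs0, one_mul]; exact Real.sqrt_le_one.2 hε1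
  have hT : (⌈C / √ε⌉₊ : ℝ) ≤ (C + 1) / √ε := by
    have := (Nat.ceil_lt_add_one (show 0 ≤ C / √ε by positivity)).le
    calc (⌈C / √ε⌉₊ : ℝ) ≤ C / √ε + 1 := this
      _ ≤ C / √ε + 1 / √ε := by gcongr
      _ = _ := by ring
  refine ⟨⌈C / √ε⌉₊, fun n hn => ?_, ?_, ?_⟩
  · have hrate := suboptimality_convexRun_le hW hm hL hf hg hmin hΔ hD hS n
    rw [← hE] at hrate
    have hn0 : (0 : ℝ) ≤ n := n.cast_nonneg
    have h1 : C / √ε ≤ n := (Nat.le_ceil _).trans (by exact_mod_cast hn)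
    have h2 : C ^ 2 ≤ n ^ 2 * ε := by
      rw [div_le_iff₀ hs0] at h1
      calc C ^ 2 ≤ (n * √ε) ^ 2 := by gcongr
        _ = _ := by rw [mul_pow, Real.sq_sqrt hε.le]
    refine le_of_mul_le_mul_left ?_ (show (0 : ℝ) < ((n : ℝ) + 4) ^ 2 / 4 by positivity)
    have h3 : (n : ℝ) ^ 2 * ε ≤ ((n : ℝ) + 4) ^ 2 * ε := by gcongr; linarith
    linarith
  · rw [gradCalls_convexRun]
    push_cast
    calc (⌈C / √ε⌉₊ : ℝ) + 1 ≤ (C + 1) / √ε + 1 / √ε := by gcongr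
      _ = _ := by ring
  · rw [rounds_convexRun, Real.sqrt_mul hε.le]
    push_cast
    have hu0 : 0 < √(1 - lambda2 W) := Real.sqrt_pos.2 (by linarith)
    calc 3 * (mixSteps W : ℝ) * ⌈C / √ε⌉₊
        ≤ 3 * (16 / √(1 - lambda2 W)) * ((C + 1) / √ε) := by
          gcongr
          exact mixSteps_le hl0 hl1
      _ = _ := by field_simp; norm_num
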